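/- Let $M$ be a connected smooth manifold of dimension $n$ with a Riemannian metric $g$, Levi-Civita connection $\nabla$ and scalar curvature $r$ (of $\nabla$). Let $(\phi,\xi,\eta,g)$ be an almost contact metric structure on $M$: a smooth $(1,1)$-tensor field $\phi$, vector field $\xi$ and 1-form $\eta$ with $\phi^2X=-X+\eta(X)\xi$, $\eta(\xi)=1$, $\eta\circ\phi=0$, $\phi\xi=0$, $g(\phi X,\phi Y)=g(X,Y)-\eta(X)\eta(Y)$, $g(X,\phi Y)=-g(\phi X,Y)$, $g(X,\xi)=\eta(X)$. Put $\Phi(X,Y)=g(\phi X,Y)$ and suppose that, for a real number $\alpha$, the structure is $\alpha$-cosymplectic: $d\eta=0$, $d\Phi=2\alpha\,\eta\wedge\Phi$, and the structure is normal, i.e. $[\phi X,\phi Y]-\phi[\phi X,Y]-\phi[X,\phi Y]+\phi^2[X,Y]+2d\eta(X,Y)\xi=0$ for all vector fields $X,Y$. Let $\tilde\nabla$ be a quarter-symmetric metric connection on $M$, i.e. a linear connection with $\tilde\nabla g=0$ and torsion $T(X,Y)=\eta(Y)\phi X-\eta(X)\phi Y$. With $\tilde R(X,Y)Z=\tilde\nabla_X\tilde\nabla_YZ-\tilde\nabla_Y\tilde\nabla_XZ-\tilde\nabla_{[X,Y]}Z$,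 put $(\tilde{\mathcal L}_\xi g)(X,Y)=g(\tilde\nabla_X\xi,Y)+g(X,\tilde\nabla_Y\xi)$, let $\tilde S^{\ast}(X,Y)=\tfrac12\operatorname{Tr}\big(\phi\circ\tilde R(X,\phi Y)\big)$ be the $\ast$-Ricci tensor of $\tilde\nabla$ and $\tilde r^{\ast}=\operatorname{Tr}_g\tilde S^{\ast}$ its $\ast$-scalar curvature. Suppose that $M$ admits a $\ast$-$\eta$-Yamabe soliton with respect to $\tilde\nabla$: there are real constants $\Lambda,\mu$ with $$\tilde{\mathcal L}_\xi g+(2\Lambda-\tilde r^{\ast})\,g+2\mu\,\eta\otimes\eta=0$$ (the case $\rho=0$, $q=1$ of $\tilde{\mathcal L}_\xi g+2\rho\tilde S^{\ast}+(2\Lambda-q\tilde r^{\ast})g+2\mu\,\eta\otimes\eta=0$). Such a soliton is called expanding, steady or shrinking according as $\Lambda>0$, $\Lambda=0$ or $\Lambda<0$. Suppose further that $\xi=\operatorname{grad}f$ for a smooth function $f:M\to\mathbb R$ that is harmonic, $\Delta f=\operatorname{div}\operatorname{grad}f=0$. Then at every point of $M$: the soliton is expanding if and only if $\tfrac12\{r+\alpha^2(n-1)^2\}>\mu$,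 steady if and only if $\tfrac12\{r+\alpha^2(n-1)^2\}=\mu$, and shrinking if and only if $\tfrac12\{r+\alpha^2(n-1)^2\}<\mu$. -/

import Mathlib

open Bundle
open scoped Manifold ContDiff

noncomputable section

namespace AlphaCosymplectic

variable {n : ℕ} {M : Type*} [TopologicalSpace M] [ChartedSpace (EuclideanSpace ℝ (Fin n)) M]
  [IsManifold (𝓡 n) ∞ M]

instance instFiniteDimensionalTangentSpace (x : M) :
    FiniteDimensional ℝ (TangentSpace (𝓡 n) x) :=
  inferInstanceAs (FiniteDimensional ℝ (EuclideanSpace ℝ (Fin n)))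

variable (n M) in
/-- Linear connections on the tangent bundle of `M`; `∇_v Y` at the point `x` is written
`D Y x v`. -/
abbrev LinearConnection : Type _ :=
  CovariantDerivative (𝓡 n) (EuclideanSpace ℝ (Fin n)) (TangentSpace (𝓡 n) : M → Type _)

/-- The vector field `X` is differentiable at `x`. -/
def IsDiffAt (X : Π x : M, TangentSpace (𝓡 n) x) (x : M) : Prop :=
  MDifferentiableAt (𝓡 n) ((𝓡 n).prod 𝓘(ℝ, EuclideanSpace ℝ (Fin n)))
    (fun y ↦ TotalSpace.mk' (EuclideanSpace ℝ (Fin n))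
      (E := fun x : M ↦ TangentSpace (𝓡 n) x) y (X y)) x

/-- `R(X, Y)Z = ∇_X ∇_Y Z - ∇_Y ∇_X Z - ∇_{[X, Y]} Z` for vector fields `X`, `Y`, `Z`. -/
def curvatureOfFields (D : LinearConnection n M) (X Y Z : Π x : M, TangentSpace (𝓡 n) x)
    (x : M) : TangentSpace (𝓡 n) x :=
  D (fun y ↦ D Z y (Y y)) x (X x) - D (fun y ↦ D Z y (X y)) x (Y x)
    - D Z x (VectorField.mlieBracket (𝓡 n) X Y x)

/-- The curvature tensor `R(u, v)w` of a smooth connection on tangent vectors at `x`. The vectors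
are extended to vector fields that are smooth near `x`; the value does not depend on the choice
of the extensions, as `curvatureOfFields` is tensorial. -/
def curvature (D : LinearConnection n M) (x : M) (u v w : TangentSpace (𝓡 n) x) :
    TangentSpace (𝓡 n) x :=
  curvatureOfFields D
    (FiberBundle.extend (EuclideanSpace ℝ (Fin n)) (E := (TangentSpace (𝓡 n) : M → Type _)) u)
    (FiberBundle.extend (EuclideanSpace ℝ (Fin n)) (E := (TangentSpace (𝓡 n) : M → Type _)) v)
    (FiberBundle.extend (EuclideanSpace ℝ (Fin n)) (E := (TangentSpace (𝓡 n) : M → Type _)) w) x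

section Riemannian

variable [RiemannianBundle (fun x : M ↦ TangentSpace (𝓡 n) x)]

/-- The trace with respect to the metric of a bilinear form on the tangent space at `x`:
`∑ i, B(eᵢ, eᵢ)` over an orthonormal basis. -/
def metricTrace (x : M) (B : TangentSpace (𝓡 n) x → TangentSpace (𝓡 n) x → ℝ) : ℝ :=
  ∑ i, B (stdOrthonormalBasis ℝ (TangentSpace (𝓡 n) x) i)
    (stdOrthonormalBasis ℝ (TangentSpace (𝓡 n) x) i)

/-- The gradient of a function: `g(grad f, v) = df(v)`. -/
def gradient (f : M → ℝ) (x : M) : TangentSpace (𝓡 n) x :=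
  (InnerProductSpace.toDual ℝ (TangentSpace (𝓡 n) x)).symm (mvfderiv (𝓡 n) f x)

/-- Ricci tensor of a connection: `S(v, w) = ∑ i, g(R(eᵢ, v)w, eᵢ)`. -/
def ricci (D : LinearConnection n M) (x : M) (v w : TangentSpace (𝓡 n) x) : ℝ :=
  metricTrace x fun a b ↦ inner ℝ (curvature D x a v w) b

/-- Scalar curvature of a connection: the trace of its Ricci tensor. -/
def scalarCurvature (D : LinearConnection n M) (x : M) : ℝ :=
  metricTrace x (ricci D x)

/-- Divergence of a vector field with respect to a connection: the trace of `v ↦ ∇_v X`. -/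
def divergence (D : LinearConnection n M) (X : Π x : M, TangentSpace (𝓡 n) x) (x : M) : ℝ :=
  metricTrace x fun a b ↦ inner ℝ (D X x a) b

/-- `Δ f = div (grad f)`. -/
def laplacian (D : LinearConnection n M) (f : M → ℝ) (x : M) : ℝ :=
  divergence D (gradient f) x

/-- The Lie derivative of the metric along `V` taken with respect to a connection `D`:
`(𝓛_V g)(v, w) = g(D_v V, w) + g(v, D_w V)`. For the Levi-Civita connection it is the usual Lie
derivative of `g`. -/
def lieDerivMetric (D : LinearConnection n M) (V : Π x : M, TangentSpace (𝓡 n) x) (x : M)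
    (v w : TangentSpace (𝓡 n) x) : ℝ :=
  inner ℝ (D V x v) w + inner ℝ v (D V x w)

section LeviCivita

variable [IsContMDiffRiemannianBundle (𝓡 n) ∞ (EuclideanSpace ℝ (Fin n))
  (fun x : M ↦ TangentSpace (𝓡 n) x)]

instance instIsContMDiffRiemannianBundleOne :
    IsContMDiffRiemannianBundle (𝓡 n) 1 (EuclideanSpace ℝ (Fin n))
      (fun x : M ↦ TangentSpace (𝓡 n) x) :=
  IsContMDiffRiemannianBundle.of_le (n := ∞) (by exact_mod_cast le_top)

/-- `D` is the Levi-Civita connection of the metric: smooth, metric and torsion free. -/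
structure IsLeviCivita (D : LinearConnection n M) : Prop where
  smooth : CovariantDerivative.ContMDiffCovariantDerivative D ∞
  metric : D.IsMetricCompatible
  torsion_free : ∀ (x : M) (u v : TangentSpace (𝓡 n) x), D.torsion x u v = 0

end LeviCivita

variable (n M) in
/-- An almost contact metric structure `(φ, ξ, η, g)`; the compatible metric `g` is the given
Riemannian metric of `M`. -/
structure AlmostContactMetricStructure where
  φ : Π x : M, TangentSpace (𝓡 n) x →L[ℝ] TangentSpace (𝓡 n) x
  ξ : Π x : M, TangentSpace (𝓡 n) x
  η : Π x : M, TangentSpace (𝓡 n) x →L[ℝ] ℝ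
  φ_smooth : ContMDiff (𝓡 n)
    ((𝓡 n).prod 𝓘(ℝ, EuclideanSpace ℝ (Fin n) →L[ℝ] EuclideanSpace ℝ (Fin n))) ∞
    (fun x ↦ TotalSpace.mk' (EuclideanSpace ℝ (Fin n) →L[ℝ] EuclideanSpace ℝ (Fin n))
      (E := fun x : M ↦ TangentSpace (𝓡 n) x →L[ℝ] TangentSpace (𝓡 n) x) x (φ x))
  ξ_smooth : ContMDiff (𝓡 n) ((𝓡 n).prod 𝓘(ℝ, EuclideanSpace ℝ (Fin n))) ∞
    (fun x ↦ TotalSpace.mk' (EuclideanSpace ℝ (Fin n))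
      (E := fun x : M ↦ TangentSpace (𝓡 n) x) x (ξ x))
  η_smooth : ContMDiff (𝓡 n) ((𝓡 n).prod 𝓘(ℝ, EuclideanSpace ℝ (Fin n) →L[ℝ] ℝ)) ∞
    (fun x ↦ TotalSpace.mk' (EuclideanSpace ℝ (Fin n) →L[ℝ] ℝ)
      (E := fun x : M ↦ TangentSpace (𝓡 n) x →L[ℝ] ℝ) x (η x))
  φ_sq : ∀ (x : M) (v : TangentSpace (𝓡 n) x), φ x (φ x v) = -v + η x v • ξ x
  η_ξ : ∀ x : M, η x (ξ x) = 1
  η_φ : ∀ (x : M) (v : TangentSpace (𝓡 n) x), η x (φ x v) = 0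
  φ_ξ : ∀ x : M, φ x (ξ x) = 0
  inner_φ_φ : ∀ (x : M) (v w : TangentSpace (𝓡 n) x),
    inner ℝ (φ x v) (φ x w) = inner ℝ v w - η x v * η x w
  inner_φ_right : ∀ (x : M) (v w : TangentSpace (𝓡 n) x),
    inner ℝ v (φ x w) = -inner ℝ (φ x v) w
  inner_ξ : ∀ (x : M) (v : TangentSpace (𝓡 n) x), inner ℝ v (ξ x) = η x v

namespace AlmostContactMetricStructure

variable (A : AlmostContactMetricStructure n M)

/-- The vector field `φX`. -/
def φField (X : Π x : M, TangentSpace (𝓡 n) x) : Π x : M, TangentSpace (𝓡 n) x :=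
  fun x ↦ A.φ x (X x)

/-- The fundamental 2-form `Φ(v, w) = g(φv, w)`. -/
def Φ (x : M) (v w : TangentSpace (𝓡 n) x) : ℝ := inner ℝ (A.φ x v) w

/-- The exterior derivative of `η` on vector fields:
`X(η(Y)) - Y(η(X)) - η([X, Y])`. -/
def dη (X Y : Π x : M, TangentSpace (𝓡 n) x) (x : M) : ℝ :=
  mvfderiv (𝓡 n) (fun y ↦ A.η y (Y y)) x (X x) - mvfderiv (𝓡 n) (fun y ↦ A.η y (X y)) x (Y x)
    - A.η x (VectorField.mlieBracket (𝓡 n) X Y x)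

/-- The exterior derivative of `Φ` on vector fields. -/
def dΦ (X Y Z : Π x : M, TangentSpace (𝓡 n) x) (x : M) : ℝ :=
  mvfderiv (𝓡 n) (fun y ↦ A.Φ y (Y y) (Z y)) x (X x)
    - mvfderiv (𝓡 n) (fun y ↦ A.Φ y (X y) (Z y)) x (Y x)
    + mvfderiv (𝓡 n) (fun y ↦ A.Φ y (X y) (Y y)) x (Z x)
    - A.Φ x (VectorField.mlieBracket (𝓡 n) X Y x) (Z x)
    + A.Φ x (VectorField.mlieBracket (𝓡 n) X Z x) (Y x)
    - A.Φ x (VectorField.mlieBracket (𝓡 n) Y Z x) (X x)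

/-- The wedge product `η ∧ Φ`, normalized consistently with `dΦ`. -/
def ηWedgeΦ (x : M) (u v w : TangentSpace (𝓡 n) x) : ℝ :=
  A.η x u * A.Φ x v w - A.η x v * A.Φ x u w + A.η x w * A.Φ x u v

/-- The normality tensor `[φ, φ] + 2 dη ⊗ ξ`. The customary factor `2` belongs to the
normalization of `dη` with a factor `1/2`; it is absorbed here, as `dη` above has none. -/
def normalityTensor (X Y : Π x : M, TangentSpace (𝓡 n) x) (x : M) : TangentSpace (𝓡 n) x :=
  VectorField.mlieBracket (𝓡 n) (A.φField X) (A.φField Y) x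
    - A.φ x (VectorField.mlieBracket (𝓡 n) (A.φField X) Y x)
    - A.φ x (VectorField.mlieBracket (𝓡 n) X (A.φField Y) x)
    + A.φ x (A.φ x (VectorField.mlieBracket (𝓡 n) X Y x))
    + A.dη X Y x • A.ξ x

/-- `α`-cosymplectic: `dη = 0`, `dΦ = 2α η ∧ Φ` and normality. The tensorial identities at a point
`x` are tested on vector fields that are differentiable at `x`. -/
structure IsAlphaCosymplectic (α : ℝ) : Prop where
  dη_eq_zero : ∀ (x : M) (X Y : Π x : M, TangentSpace (𝓡 n) x),
    IsDiffAt X x → IsDiffAt Y x → A.dη X Y x = 0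
  dΦ_eq : ∀ (x : M) (X Y Z : Π x : M, TangentSpace (𝓡 n) x),
    IsDiffAt X x → IsDiffAt Y x → IsDiffAt Z x →
      A.dΦ X Y Z x = 2 * α * A.ηWedgeΦ x (X x) (Y x) (Z x)
  normal : ∀ (x : M) (X Y : Π x : M, TangentSpace (𝓡 n) x),
    IsDiffAt X x → IsDiffAt Y x → A.normalityTensor X Y x = 0

/-- The `∗`-Ricci tensor of a connection: `S∗(v, w) = (1/2) Tr (φ ∘ R(v, φw))`. -/
def starRicci (D : LinearConnection n M) (x : M) (v w : TangentSpace (𝓡 n) x) : ℝ :=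
  (1 / 2 : ℝ) * metricTrace x fun a b ↦ inner ℝ (A.φ x (curvature D x v (A.φ x w) a)) b

/-- The `∗`-scalar curvature of a connection: the trace of its `∗`-Ricci tensor. -/
def starScalarCurvature (D : LinearConnection n M) (x : M) : ℝ :=
  metricTrace x (A.starRicci D x)

/-- The `∗`-`η`-Ricci-Yamabe soliton equation of type `(ρ, q)` with constants `Λ`, `μ` and potential
vector field `ξ`, with respect to a connection `D`:
`𝓛_ξ g + 2ρ S∗ + (2Λ - q r∗) g + 2μ η ⊗ η = 0`, where `𝓛_ξ`, `S∗`, `r∗` are those of `D`. -/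
def IsStarEtaRicciYamabeSoliton (D : LinearConnection n M) (ρ q Λ μ : ℝ) : Prop :=
  ∀ (x : M) (v w : TangentSpace (𝓡 n) x),
    lieDerivMetric D A.ξ x v w + 2 * ρ * A.starRicci D x v w
      + (2 * Λ - q * A.starScalarCurvature D x) * inner ℝ v w
      + 2 * μ * (A.η x v * A.η x w) = 0

/-- The `∗`-`η`-Yamabe soliton: type `(ρ, q) = (0, 1)`. -/
def IsStarEtaYamabeSoliton (D : LinearConnection n M) (Λ μ : ℝ) : Prop :=
  A.IsStarEtaRicciYamabeSoliton D 0 1 Λ μ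

variable [IsContMDiffRiemannianBundle (𝓡 n) ∞ (EuclideanSpace ℝ (Fin n))
  (fun x : M ↦ TangentSpace (𝓡 n) x)]

/-- `D` is a quarter-symmetric metric connection for `(φ, ξ, η, g)`: smooth, metric, with torsion
`T(u, v) = η(v) φu - η(u) φv`. -/
structure IsQuarterSymmetricMetric (D : LinearConnection n M) : Prop where
  smooth : CovariantDerivative.ContMDiffCovariantDerivative D ∞
  metric : D.IsMetricCompatible
  torsion_eq : ∀ (x : M) (u v : TangentSpace (𝓡 n) x),
    D.torsion x u v = A.η x v • A.φ x u - A.η x u • A.φ x v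

end AlmostContactMetricStructure

end Riemannian

/-- Nature of a soliton `𝓛_ξ g + 2ρ S∗ + (2Λ - q r∗) g + 2μ η ⊗ η = 0`. In the normalization
`𝓛_V g + 2ρ S = (2λ - q r) g` of Ricci-Yamabe solitons, with the constant on the right,
expanding, steady, shrinking mean `λ < 0`, `λ = 0`, `0 < λ`; here the constant stands on the left,
so that `λ = -Λ`. -/
def IsExpanding (Λ : ℝ) : Prop := 0 < Λ

/-- See `IsExpanding`. -/
def IsSteady (Λ : ℝ) : Prop := Λ = 0

/-- See `IsExpanding`. -/
def IsShrinking (Λ : ℝ) : Prop := Λ < 0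

end AlphaCosymplectic

end

/-!
The soliton equation at `(ξ, ξ)` involves `g(∇̃_ξ ξ, ξ)`, which vanishes because `∇̃` is metric and
`ξ` has unit length. It therefore says `Λ + μ = r̃∗ / 2`, and the theorem amounts to
`r̃∗ = r + α² (n - 1)²`.

For an `α`-cosymplectic structure, `dη = 0`, normality and `dΦ = 2α η ∧ Φ`, all evaluated with one
argument `ξ`, give `∇_v ξ = α (v - η(v) ξ)` (`IsAlphaCosymplectic.connection_ξ`), so that
`Δ f = div ξ = (n - 1) α`. Harmonicity of `f` leaves two cases. If `n = 1`, then `φ = 0` and both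
curvatures vanish. If `α = 0`, the structure is cosymplectic and behaves like a Kähler structure:
`∇φ = 0` (`IsAlphaCosymplectic.covφ_eq_zero`), hence the curvature operators commute with `φ` and
kill `ξ`. As `∇̃ = ∇ - η ⊗ φ` (`IsQuarterSymmetricMetric.connection_eq`) with `dη = 0` and
`∇φ = 0`, both connections have the same curvature, and the Bianchi identity gives `r∗ = r`
(`IsAlphaCosymplectic.starScalarCurvature_eq`).

The curvature in the statement is computed on the coordinate fields of the chart at the point. These
commute, which makes the symmetries of the Riemann tensor short: only second derivatives have to be
interchanged. Tensoriality in the last argument comes for free from the skew-adjointness of the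
curvature operator.
-/

noncomputable section

namespace AlphaCosymplectic

open Filter Topology

/-! ### Coordinate vector fields of a chart -/

section ExtensionFields

variable {n : ℕ} {M : Type*} [TopologicalSpace M] [ChartedSpace (EuclideanSpace ℝ (Fin n)) M]
  [IsManifold (𝓡 n) ∞ M]

/-- The vector field that is constant in the chart at `x`, with value `v` at `x`. This is the
extension used in the definition of `curvature`. -/
abbrev extField {x : M} (v : TangentSpace (𝓡 n) x) : Π y : M, TangentSpace (𝓡 n) y :=
  FiberBundle.extend (EuclideanSpace ℝ (Fin n)) (E := (TangentSpace (𝓡 n) : M → Type _)) v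

/-- The vector field `X` is smooth in a neighbourhood of `x`. -/
def IsSmoothNear (X : Π x : M, TangentSpace (𝓡 n) x) (x : M) : Prop :=
  ∀ᶠ y in 𝓝 x, ContMDiffAt (𝓡 n) ((𝓡 n).prod 𝓘(ℝ, EuclideanSpace ℝ (Fin n))) ∞
    (fun y ↦ TotalSpace.mk' (EuclideanSpace ℝ (Fin n))
      (E := fun x : M ↦ TangentSpace (𝓡 n) x) y (X y)) y

lemma IsSmoothNear.eventually {X : Π x : M, TangentSpace (𝓡 n) x} {x : M}
    (h : IsSmoothNear X x) : ∀ᶠ y in 𝓝 x, IsSmoothNear X y :=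
  eventually_eventually_nhds.2 h

lemma IsSmoothNear.isDiffAt {X : Π x : M, TangentSpace (𝓡 n) x} {x : M}
    (h : IsSmoothNear X x) : IsDiffAt X x :=
  h.self_of_nhds.mdifferentiableAt (by simp)

lemma isSmoothNear_ext {x : M} (v : TangentSpace (𝓡 n) x) : IsSmoothNear (extField v) x := by
  obtain ⟨s, hs, h⟩ := FiberBundle.exists_contMDiffOn_extend (k := ∞) (𝓡 n)
    (EuclideanSpace ℝ (Fin n)) (V := (TangentSpace (𝓡 n) : M → Type _)) v
  filter_upwards [eventually_mem_nhds_iff.2 hs] with y hy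
  exact h.contMDiffAt hy

lemma isDiffAt_ext {x : M} (v : TangentSpace (𝓡 n) x) : IsDiffAt (extField v) x :=
  (isSmoothNear_ext v).isDiffAt

@[simp] lemma extField_self {x : M} (v : TangentSpace (𝓡 n) x) : extField v x = v :=
  FiberBundle.extend_apply_self _ v

/-- The coordinate vector of `extField v` in the chart at `x`. -/
def chartVec {x : M} (v : TangentSpace (𝓡 n) x) : EuclideanSpace ℝ (Fin n) :=
  (trivializationAt (EuclideanSpace ℝ (Fin n)) (TangentSpace (𝓡 n) : M → Type _) x ⟨x, v⟩).2

/-- The constant vector field on the model space with the coordinates of `extField v`. -/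
def chartField {x : M} (v : TangentSpace (𝓡 n) x) :
    Π z : EuclideanSpace ℝ (Fin n), TangentSpace 𝓘(ℝ, EuclideanSpace ℝ (Fin n)) z :=
  fun _ ↦ chartVec v

lemma mfderiv_chart_ext {x : M} (v : TangentSpace (𝓡 n) x) {y : M}
    (hy : y ∈ (chartAt (EuclideanSpace ℝ (Fin n)) x).source) :
    mfderiv (𝓡 n) 𝓘(ℝ, EuclideanSpace ℝ (Fin n)) (extChartAt (𝓡 n) x) y (extField v y)
      = chartField v (extChartAt (𝓡 n) x y) := by
  have h := TangentBundle.continuousLinearMapAt_trivializationAt (I := 𝓡 n) hy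
  have hy' : y ∈ (trivializationAt (EuclideanSpace ℝ (Fin n))
    (TangentSpace (𝓡 n) : M → Type _) x).baseSet := by simpa using hy
  have h2 : extField v y = (trivializationAt (EuclideanSpace ℝ (Fin n))
    (TangentSpace (𝓡 n) : M → Type _) x).symmL ℝ y (chartVec v) := by
    rw [Trivialization.symmL_apply _ hy']
    rfl
  have h3 := (trivializationAt (EuclideanSpace ℝ (Fin n))
    (TangentSpace (𝓡 n) : M → Type _) x).continuousLinearMapAt_symmL (R := ℝ) hy' (chartVec v)
  rw [← h2] at h3
  exact (congrArg (fun L ↦ L (extField v y)) h).symm.trans h3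

lemma ext_eq_mpullback {x : M} (v : TangentSpace (𝓡 n) x) {y : M}
    (hy : y ∈ (chartAt (EuclideanSpace ℝ (Fin n)) x).source) :
    extField v y = VectorField.mpullback (𝓡 n) 𝓘(ℝ, EuclideanSpace ℝ (Fin n)) (extChartAt (𝓡 n) x)
      (chartField v) y := by
  have hinv := isInvertible_mfderiv_extChartAt (I := 𝓡 n) (x := x) (y := y) (by simpa using hy)
  rw [VectorField.mpullback_apply, ← mfderiv_chart_ext v hy]
  obtain ⟨e, he⟩ := hinv
  rw [← he, ContinuousLinearMap.inverse_equiv]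
  exact (e.symm_apply_apply _).symm

/-- Extension fields are coordinate fields of one chart, so they commute. -/
lemma mlieBracket_ext {x : M} (u v : TangentSpace (𝓡 n) x) :
    ∀ᶠ y in 𝓝 x, VectorField.mlieBracket (𝓡 n) (extField u) (extField v) y = 0 := by
  filter_upwards [eventually_eventually_nhds.2 (chart_source_mem_nhds (EuclideanSpace ℝ (Fin n)) x)]
    with y hy
  have h2 : (2 : ℕ∞ω) ≤ ∞ := WithTop.coe_le_coe.2 (le_top (a := (2 : ℕ∞)))
  have : IsManifold (𝓡 n) (minSmoothness ℝ 2) M := IsManifold.of_le (n := ∞) (by simpa using h2)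
  have hu : extField u =ᶠ[𝓝 y] _ := hy.mono fun z hz ↦ ext_eq_mpullback u hz
  have hv : extField v =ᶠ[𝓝 y] _ := hy.mono fun z hz ↦ ext_eq_mpullback v hz
  have hd (w : TangentSpace (𝓡 n) x) (z : EuclideanSpace ℝ (Fin n)) :
      MDifferentiableAt 𝓘(ℝ, EuclideanSpace ℝ (Fin n))
        (𝓘(ℝ, EuclideanSpace ℝ (Fin n)).prod 𝓘(ℝ, EuclideanSpace ℝ (Fin n)))
        (fun z ↦ (TotalSpace.mk' (EuclideanSpace ℝ (Fin n)) z (chartField w z) :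
          TangentBundle 𝓘(ℝ, EuclideanSpace ℝ (Fin n)) (EuclideanSpace ℝ (Fin n)))) z := by
    refine ContMDiffAt.mdifferentiableAt (n := 1) ?_ one_ne_zero
    exact contMDiffAt_vectorSpace_iff_contDiffAt.2 contDiffAt_const
  rw [hu.mlieBracket_vectorField_eq hv,
    ← VectorField.mpullback_mlieBracket (n := ∞) (hd u _) (hd v _)
      (contMDiffAt_extChartAt' hy.self_of_nhds) (by simpa using h2)]
  have h0 : VectorField.lieBracketWithin ℝ (fun _ : EuclideanSpace ℝ (Fin n) ↦ chartVec u)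
      (fun _ ↦ chartVec v) Set.univ (extChartAt (𝓡 n) x y) = 0 := by
    simp [VectorField.lieBracketWithin]
  have h1 : VectorField.mlieBracket 𝓘(ℝ, EuclideanSpace ℝ (Fin n)) (chartField u) (chartField v)
      (extChartAt (𝓡 n) x y) = 0 := by
    rw [← VectorField.mlieBracketWithin_univ, VectorField.mlieBracketWithin_eq_lieBracketWithin]
    exact h0
  rw [VectorField.mpullback_apply, h1, map_zero]

/-- Derivatives of a function along two extension fields commute. -/
lemma mvfderiv_ext_comm {x : M} (u v : TangentSpace (𝓡 n) x) {f : M → ℝ}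
    (hf : ContMDiffAt (𝓡 n) 𝓘(ℝ, ℝ) ∞ f x) :
    mvfderiv (𝓡 n) (fun y ↦ mvfderiv (𝓡 n) f y (extField v y)) x u
      = mvfderiv (𝓡 n) (fun y ↦ mvfderiv (𝓡 n) f y (extField u y)) x v := by
  have h2 : (2 : ℕ∞ω) ≤ ∞ := WithTop.coe_le_coe.2 (le_top (a := (2 : ℕ∞)))
  set φ := extChartAt (𝓡 n) x with hφ
  set g : EuclideanSpace ℝ (Fin n) → ℝ := f ∘ φ.symm with hg
  have hgs : ContDiffAt ℝ ∞ g (φ x) := by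
    have := (contMDiffAt_iff.1 hf).2
    simpa [contDiffWithinAt_univ] using! this
  -- Near `x`, `f` is the composition of `g` with the chart.
  have hfd (w : TangentSpace (𝓡 n) x) : (fun y ↦ mvfderiv (𝓡 n) f y (extField w y)) =ᶠ[𝓝 x]
      (fun z ↦ fderiv ℝ g z (chartVec w)) ∘ φ := by
    have hdiff : ∀ᶠ y in 𝓝 x, DifferentiableAt ℝ g (φ y) := by
      refine (continuousAt_extChartAt (I := 𝓡 n) x).eventually ?_
      have h1 : ContDiffAt ℝ 1 g (φ x) := hgs.of_le (by exact_mod_cast le_top)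
      exact (h1.eventually (by simp)).mono fun z hz ↦ hz.differentiableAt one_ne_zero
    filter_upwards [hdiff,
      eventually_eventually_nhds.2 (chart_source_mem_nhds (EuclideanSpace ℝ (Fin n)) x)]
      with y hy hys
    have hfg : f =ᶠ[𝓝 y] g ∘ φ := by
      filter_upwards [hys] with z hz
      have : φ.symm (φ z) = z := φ.left_inv (by rw [hφ, extChartAt_source]; exact hz)
      simp [hg, this]
    have hφd : MDifferentiableAt (𝓡 n) 𝓘(ℝ, EuclideanSpace ℝ (Fin n)) φ y :=
      mdifferentiableAt_extChartAt hys.self_of_nhds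
    have e1 : mvfderiv (𝓡 n) f y = mvfderiv (𝓡 n) (g ∘ φ) y := hfg.mfderiv_eq
    rw [e1, mvfderiv_comp_apply y hy.mdifferentiableAt hφd, mfderiv_chart_ext w hys.self_of_nhds]
    simp only [mvfderiv, mfderiv_eq_fderiv]
    rfl
  have hd2 (w w' : TangentSpace (𝓡 n) x) :
      mvfderiv (𝓡 n) (fun y ↦ mvfderiv (𝓡 n) f y (extField w y)) x w'
        = fderiv ℝ (fderiv ℝ g) (φ x) (chartVec w') (chartVec w) := by
    have hdd : DifferentiableAt ℝ (fderiv ℝ g) (φ x) :=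
      (hgs.fderiv_right (m := 1) (by exact_mod_cast h2)).differentiableAt one_ne_zero
    have hdw : DifferentiableAt ℝ (fun z ↦ fderiv ℝ g z (chartVec w)) (φ x) :=
      hdd.clm_apply (differentiableAt_const _)
    have e1 : mvfderiv (𝓡 n) (fun y ↦ mvfderiv (𝓡 n) f y (extField w y)) x
        = mvfderiv (𝓡 n) ((fun z ↦ fderiv ℝ g z (chartVec w)) ∘ φ) x := (hfd w).mfderiv_eq
    have e2 := mfderiv_chart_ext w' (mem_chart_source (EuclideanSpace ℝ (Fin n)) x)
    rw [extField_self] at e2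
    rw [e1, mvfderiv_comp_apply x hdw.mdifferentiableAt
      (mdifferentiableAt_extChartAt (mem_chart_source _ x)), e2]
    have e3 : fderiv ℝ (fun z ↦ fderiv ℝ g z (chartVec w)) (φ x) (chartVec w')
        = fderiv ℝ (fderiv ℝ g) (φ x) (chartVec w') (chartVec w) := by
      rw [fderiv_clm_apply hdd (differentiableAt_const _)]
      simp
    rw [← e3]
    simp only [mvfderiv, mfderiv_eq_fderiv]
    rfl
  rw [hd2, hd2]
  exact (hgs.isSymmSndFDerivAt (by simpa using h2)) _ _

end ExtensionFields

/-! ### Smooth connections and the symmetries of the curvature -/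

section Connection

variable {n : ℕ} {M : Type*} [TopologicalSpace M] [T2Space M]
  [ChartedSpace (EuclideanSpace ℝ (Fin n)) M] [IsManifold (𝓡 n) ∞ M]

lemma IsSmoothNear.exists_global {X : Π x : M, TangentSpace (𝓡 n) x} {x : M}
    (h : IsSmoothNear X x) : ∃ X' : Π x : M, TangentSpace (𝓡 n) x,
      ContMDiff (𝓡 n) ((𝓡 n).prod 𝓘(ℝ, EuclideanSpace ℝ (Fin n))) ∞
        (fun y ↦ TotalSpace.mk' (EuclideanSpace ℝ (Fin n))
          (E := fun x : M ↦ TangentSpace (𝓡 n) x) y (X' y)) ∧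
      ∀ᶠ y in 𝓝 x, X' y = X y := by
  obtain ⟨U, hU, hUo, hxU⟩ := eventually_nhds_iff.1 h
  obtain ⟨ψ, hψ⟩ := (SmoothBumpFunction.nhds_basis_support (I := 𝓡 n)
    (hUo.mem_nhds hxU)).ex_mem
  refine ⟨(ψ : M → ℝ) • X, ?_, ?_⟩
  · exact ContMDiffOn.smul_section_of_tsupport ψ.contMDiff.contMDiffOn hUo hψ
      fun y hy ↦ (hU y hy).contMDiffWithinAt
  · filter_upwards [ψ.eventuallyEq_one] with y hy
    simp [hy]

omit [T2Space M] in
lemma connection_congr (D : LinearConnection n M) {X X' : Π x : M, TangentSpace (𝓡 n) x} {x : M}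
    (hX : IsDiffAt X x) (hX' : IsDiffAt X' x) (h : ∀ᶠ y in 𝓝 x, X y = X' y) : D X x = D X' x :=
  D.isCovariantDerivativeOnUniv.congr_of_eventuallyEq hX hX' univ_mem h

/-- Covariant derivatives of fields that are smooth near `x` are smooth near `x`. The smoothness of
a connection speaks of globally smooth fields only, so the field is first cut off. -/
lemma IsSmoothNear.connection {D : LinearConnection n M}
    (hD : CovariantDerivative.ContMDiffCovariantDerivative D ∞)
    {X Y : Π x : M, TangentSpace (𝓡 n) x} {x : M} (hX : IsSmoothNear X x) (hY : IsSmoothNear Y x) :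
    IsSmoothNear (fun y ↦ D X y (Y y)) x := by
  obtain ⟨X', hX', hXX'⟩ := hX.exists_global
  have hDX' := hD.contMDiff.contMDiff (σ := X') (by simpa using! hX'.contMDiffOn (s := Set.univ))
  filter_upwards [eventually_eventually_nhds.2 hXX', hX.eventually, hY.eventually] with y h1 h2 h3
  have h4 := (contMDiffOn_univ.1 hDX').contMDiffAt (x := y)
  have h5 := h4.clm_bundle_apply h3.self_of_nhds
  refine h5.congr_of_eventuallyEq ?_
  filter_upwards [eventually_eventually_nhds.2 h1, h2.eventually] with z hz hz2
  have := connection_congr D ((hX' z).mdifferentiableAt (by simp)) hz2.isDiffAt hz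
  simp only [this]

omit [T2Space M] in
lemma curvatureOfFields_ext (D : LinearConnection n M) {x : M} (u v : TangentSpace (𝓡 n) x)
    (Z : Π x : M, TangentSpace (𝓡 n) x) :
    curvatureOfFields D (extField u) (extField v) Z x
      = D (fun y ↦ D Z y (extField v y)) x u - D (fun y ↦ D Z y (extField u y)) x v := by
  rw [curvatureOfFields, (mlieBracket_ext u v).self_of_nhds, map_zero, sub_zero,
    extField_self, extField_self]

omit [T2Space M] in
lemma curvature_eq (D : LinearConnection n M) {x : M} (u v w : TangentSpace (𝓡 n) x) :
    curvature D x u v w = curvatureOfFields D (extField u) (extField v) (extField w) x := rfl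

omit [T2Space M] in
lemma curvature_swap (D : LinearConnection n M) {x : M} (u v w : TangentSpace (𝓡 n) x) :
    curvature D x u v w = -curvature D x v u w := by
  rw [curvature_eq, curvature_eq, curvatureOfFields_ext, curvatureOfFields_ext, neg_sub]

section Metric

variable [RiemannianBundle (fun x : M ↦ TangentSpace (𝓡 n) x)]
  [IsContMDiffRiemannianBundle (𝓡 n) ∞ (EuclideanSpace ℝ (Fin n))
  (fun x : M ↦ TangentSpace (𝓡 n) x)]

omit [T2Space M] in
lemma IsSmoothNear.inner {X Y : Π x : M, TangentSpace (𝓡 n) x} {x : M}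
    (hX : IsSmoothNear X x) (hY : IsSmoothNear Y x) :
    ContMDiffAt (𝓡 n) 𝓘(ℝ, ℝ) ∞ (fun y ↦ inner ℝ (X y) (Y y)) x :=
  hX.self_of_nhds.inner_bundle hY.self_of_nhds

omit [T2Space M] in
lemma IsDiffAt.inner {X Y : Π x : M, TangentSpace (𝓡 n) x} {x : M}
    (hX : IsDiffAt X x) (hY : IsDiffAt Y x) :
    MDifferentiableAt (𝓡 n) 𝓘(ℝ, ℝ) (fun y ↦ inner ℝ (X y) (Y y)) x :=
  MDifferentiableAt.inner_bundle hX hY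

omit [T2Space M] in
lemma mvfderiv_inner {D : LinearConnection n M} (hD : D.IsMetricCompatible)
    {X Y : Π x : M, TangentSpace (𝓡 n) x} {x : M} (hX : IsDiffAt X x) (hY : IsDiffAt Y x)
    (u : TangentSpace (𝓡 n) x) :
    mvfderiv (𝓡 n) (fun y ↦ (inner ℝ (X y) (Y y) : ℝ)) x u
      = inner ℝ (D X x u) (Y x) + inner ℝ (X x) (D Y x u) := by
  simpa using hD.mvfderiv_inner_eq (extField u) hX hY

omit [T2Space M] in
lemma mlieBracket_eq {D : LinearConnection n M} (hD : IsLeviCivita D)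
    {X Y : Π x : M, TangentSpace (𝓡 n) x} {x : M} (hX : IsDiffAt X x) (hY : IsDiffAt Y x) :
    VectorField.mlieBracket (𝓡 n) X Y x = D Y x (X x) - D X x (Y x) := by
  have h := D.torsion_apply hX hY
  rw [hD.torsion_free] at h
  exact (sub_eq_zero.1 h.symm).symm

/-- The curvature operator of a metric connection is skew-adjoint. On the right hand side `Z` occurs
only through its value at `x`, so this contains the tensoriality of the curvature in its last
argument. -/
lemma inner_curvatureOfFields_ext {D : LinearConnection n M}
    (hs : CovariantDerivative.ContMDiffCovariantDerivative D ∞) (hD : D.IsMetricCompatible)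
    {x : M} (u v : TangentSpace (𝓡 n) x) {Z W : Π x : M, TangentSpace (𝓡 n) x}
    (hZ : IsSmoothNear Z x) (hW : IsSmoothNear W x) :
    inner ℝ (curvatureOfFields D (extField u) (extField v) Z x) (W x)
      = -inner ℝ (Z x) (curvatureOfFields D (extField u) (extField v) W x) := by
  have key (a b : TangentSpace (𝓡 n) x) :
      mvfderiv (𝓡 n)
        (fun y ↦ mvfderiv (𝓡 n) (fun z ↦ (inner ℝ (Z z) (W z) : ℝ)) y (extField b y)) x a
      = (inner ℝ (D (fun y ↦ D Z y (extField b y)) x a) (W x) + inner ℝ (D Z x b) (D W x a))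
        + (inner ℝ (D Z x a) (D W x b) + inner ℝ (Z x) (D (fun y ↦ D W y (extField b y)) x a)) := by
    have hb := isSmoothNear_ext b
    have hDZ := hZ.connection hs hb
    have hDW := hW.connection hs hb
    have e : (fun y ↦ mvfderiv (𝓡 n) (fun z ↦ (inner ℝ (Z z) (W z) : ℝ)) y (extField b y)) =ᶠ[𝓝 x]
        (fun y ↦ inner ℝ (D Z y (extField b y)) (W y))
          + fun y ↦ inner ℝ (Z y) (D W y (extField b y)) := by
      filter_upwards [hZ.eventually, hW.eventually] with y hy1 hy2
      exact mvfderiv_inner hD hy1.isDiffAt hy2.isDiffAt _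
    have e' : mvfderiv (𝓡 n)
        (fun y ↦ mvfderiv (𝓡 n) (fun z ↦ (inner ℝ (Z z) (W z) : ℝ)) y (extField b y)) x = _ :=
      e.mfderiv_eq
    have h1 := mvfderiv_inner hD hDZ.isDiffAt hW.isDiffAt a
    have h2 := mvfderiv_inner hD hZ.isDiffAt hDW.isDiffAt a
    rw [extField_self] at h1 h2
    rw [e', ← h1, ← h2]
    exact congrArg (fun L ↦ L a) (mvfderiv_add (hDZ.isDiffAt.inner hW.isDiffAt)
      (hZ.isDiffAt.inner hDW.isDiffAt))
  have hc := mvfderiv_ext_comm u v (hZ.inner hW)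
  rw [key, key] at hc
  rw [curvatureOfFields_ext, curvatureOfFields_ext, inner_sub_left, inner_sub_right]
  linarith

lemma inner_curvature_swap {D : LinearConnection n M}
    (hs : CovariantDerivative.ContMDiffCovariantDerivative D ∞) (hD : D.IsMetricCompatible)
    {x : M} (u v w z : TangentSpace (𝓡 n) x) :
    inner ℝ (curvature D x u v w) z = -inner ℝ w (curvature D x u v z) := by
  simpa [curvature_eq] using
    inner_curvatureOfFields_ext hs hD u v (isSmoothNear_ext w) (isSmoothNear_ext z)

/-- The curvature `R(X, Y)Z` depends only on the value of the smooth field `Z` at the point. -/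
lemma curvatureOfFields_eq_curvature {D : LinearConnection n M}
    (hs : CovariantDerivative.ContMDiffCovariantDerivative D ∞) (hD : D.IsMetricCompatible)
    {x : M} (u v : TangentSpace (𝓡 n) x) {Z : Π x : M, TangentSpace (𝓡 n) x}
    (hZ : IsSmoothNear Z x) :
    curvatureOfFields D (extField u) (extField v) Z x = curvature D x u v (Z x) := by
  refine ext_inner_right ℝ fun z ↦ ?_
  have h := inner_curvatureOfFields_ext hs hD u v hZ (isSmoothNear_ext z)
  rw [extField_self] at h
  rw [h, inner_curvature_swap hs hD, curvature_eq]

/-- The first Bianchi identity. For commuting fields, `∇_X Y = ∇_Y X` near the point, and the six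
second derivatives cancel in pairs. -/
lemma curvature_bianchi {D : LinearConnection n M} (hD : IsLeviCivita D) {x : M}
    (u v w : TangentSpace (𝓡 n) x) :
    curvature D x u v w + curvature D x v w u + curvature D x w u v = 0 := by
  have comm (a b : TangentSpace (𝓡 n) x) :
      D (fun y ↦ D (extField b) y (extField a y)) x
        = D (fun y ↦ D (extField a) y (extField b y)) x := by
    have ha := isSmoothNear_ext a
    have hb := isSmoothNear_ext b
    refine connection_congr D (hb.connection hD.smooth ha).isDiffAt
      (ha.connection hD.smooth hb).isDiffAt ?_
    filter_upwards [ha.eventually, hb.eventually, mlieBracket_ext a b] with y h1 h2 h3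
    rw [mlieBracket_eq hD h1.isDiffAt h2.isDiffAt] at h3
    exact sub_eq_zero.1 h3
  simp only [curvature_eq, curvatureOfFields_ext]
  rw [comm v w, comm u w, comm u v]
  abel

/-- Pair symmetry of the Riemann tensor. -/
lemma inner_curvature_pair {D : LinearConnection n M} (hD : IsLeviCivita D) {x : M}
    (u v w z : TangentSpace (𝓡 n) x) :
    (inner ℝ (curvature D x u v w) z : ℝ) = inner ℝ (curvature D x w z u) v := by
  have B (a b c d : TangentSpace (𝓡 n) x) :
      (inner ℝ (curvature D x a b c) d : ℝ) + inner ℝ (curvature D x b c a) d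
        + inner ℝ (curvature D x c a b) d = 0 := by
    rw [← inner_add_left, ← inner_add_left, curvature_bianchi hD, inner_zero_left]
  have S (a b c d : TangentSpace (𝓡 n) x) :
      (inner ℝ (curvature D x a b c) d : ℝ) = -inner ℝ (curvature D x b a c) d := by
    rw [curvature_swap, inner_neg_left]
  have T (a b c d : TangentSpace (𝓡 n) x) :
      (inner ℝ (curvature D x a b c) d : ℝ) = -inner ℝ (curvature D x a b d) c := by
    rw [inner_curvature_swap hD.smooth hD.metric, real_inner_comm]
  linarith [B u v w z, B v w z u, B w z u v, B z u v w, S u v w z, S v w u z, S w u v z,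
    S v w z u, S w z v u, S z v w u, S w z u v, S z u w v, S u w z v, S z u v w, S u v z w,
    S v z u w, T u v w z, T v w u z, T w u v z, T w z u v, T z u w v, T v z u w, T u w z v,
    T z v w u, T z u v w, T u v z w, T v w z u, T w z v u]

lemma inner_curvature_left {D : LinearConnection n M} (hD : IsLeviCivita D) {x : M}
    (u v w z : TangentSpace (𝓡 n) x) :
    (inner ℝ (curvature D x u v w) z : ℝ) = -inner ℝ u (curvature D x w z v) := by
  rw [inner_curvature_pair hD, inner_curvature_swap hD.smooth hD.metric]

end Metric

end Connection

/-! ### The covariant derivative of an almost contact metric structure -/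

namespace AlmostContactMetricStructure

variable {n : ℕ} {M : Type*} [TopologicalSpace M]
  [ChartedSpace (EuclideanSpace ℝ (Fin n)) M] [IsManifold (𝓡 n) ∞ M]
  [RiemannianBundle (fun x : M ↦ TangentSpace (𝓡 n) x)]
  (A : AlmostContactMetricStructure n M)

lemma isSmoothNear_ξ (x : M) : IsSmoothNear A.ξ x :=
  Eventually.of_forall fun y ↦ A.ξ_smooth y

lemma _root_.AlphaCosymplectic.IsSmoothNear.φField {X : Π x : M, TangentSpace (𝓡 n) x} {x : M}
    (hX : IsSmoothNear X x) : IsSmoothNear (A.φField X) x :=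
  hX.mono fun y hy ↦ (A.φ_smooth y).clm_bundle_apply hy

lemma _root_.AlphaCosymplectic.IsDiffAt.φField {X : Π x : M, TangentSpace (𝓡 n) x} {x : M}
    (hX : IsDiffAt X x) : IsDiffAt (A.φField X) x :=
  ((A.φ_smooth x).mdifferentiableAt (by simp)).clm_bundle_apply hX

lemma φField_ξ : A.φField A.ξ = 0 := funext A.φ_ξ

lemma η_eq (x : M) (v : TangentSpace (𝓡 n) x) : A.η x v = inner ℝ v (A.ξ x) := (A.inner_ξ x v).symm

lemma inner_φ_left (x : M) (v w : TangentSpace (𝓡 n) x) :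
    (inner ℝ (A.φ x v) w : ℝ) = -inner ℝ v (A.φ x w) := by
  rw [A.inner_φ_right, neg_neg]

/-- The covariant derivative of the tensor field `φ`: `(∇_u φ)v` at the point `x`. -/
def covφ (D : LinearConnection n M) (x : M) (u v : TangentSpace (𝓡 n) x) : TangentSpace (𝓡 n) x :=
  D (A.φField (extField v)) x u - A.φ x (D (extField v) x u)

variable [IsContMDiffRiemannianBundle (𝓡 n) ∞ (EuclideanSpace ℝ (Fin n))
  (fun x : M ↦ TangentSpace (𝓡 n) x)]

section CovariantDerivativeOfPhi

variable {A} {D : LinearConnection n M}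

/-- `∇_u φ` is skew-adjoint, tested on vector fields. -/
lemma inner_covφ_fields (hD : D.IsMetricCompatible) {Y Z : Π x : M, TangentSpace (𝓡 n) x} {x : M}
    (hY : IsDiffAt Y x) (hZ : IsDiffAt Z x) (u : TangentSpace (𝓡 n) x) :
    (inner ℝ (D (A.φField Y) x u - A.φ x (D Y x u)) (Z x) : ℝ)
      = -inner ℝ (Y x) (D (A.φField Z) x u - A.φ x (D Z x u)) := by
  have h1 := mvfderiv_inner hD (IsDiffAt.φField A hY) hZ u
  have h2 := mvfderiv_inner hD hY (IsDiffAt.φField A hZ) u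
  have h3 : (fun y ↦ (inner ℝ (A.φField Y y) (Z y) : ℝ))
      = -fun y ↦ (inner ℝ (Y y) (A.φField Z y) : ℝ) :=
    funext fun y ↦ A.inner_φ_left y _ _
  rw [h3, mvfderiv_neg, neg_apply, h2] at h1
  have h4 : (inner ℝ (A.φField Y x) (D Z x u) : ℝ) = -inner ℝ (Y x) (A.φ x (D Z x u)) :=
    A.inner_φ_left x _ _
  have h5 : (inner ℝ (D Y x u) (A.φField Z x) : ℝ) = -inner ℝ (A.φ x (D Y x u)) (Z x) :=
    A.inner_φ_right x _ _
  rw [inner_sub_left, inner_sub_right]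
  linarith

lemma inner_covφ (hD : D.IsMetricCompatible) (x : M) (u v w : TangentSpace (𝓡 n) x) :
    (inner ℝ (A.covφ D x u v) w : ℝ) = -inner ℝ v (A.covφ D x u w) := by
  simpa [covφ] using inner_covφ_fields (A := A) hD (isDiffAt_ext v) (isDiffAt_ext w) u

lemma connection_φField (hD : D.IsMetricCompatible) {Y : Π x : M, TangentSpace (𝓡 n) x} {x : M}
    (hY : IsDiffAt Y x) (u : TangentSpace (𝓡 n) x) :
    D (A.φField Y) x u = A.φ x (D Y x u) + A.covφ D x u (Y x) := by
  rw [← sub_eq_iff_eq_add']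
  refine ext_inner_right ℝ fun z ↦ ?_
  have h := inner_covφ_fields (A := A) hD hY (isDiffAt_ext z) u
  rw [extField_self] at h
  rw [h, inner_covφ hD, covφ]

/-- Derivative of a value of the fundamental 2-form. -/
lemma mvfderiv_Φ (hD : D.IsMetricCompatible) {Y Z : Π x : M, TangentSpace (𝓡 n) x} {x : M}
    (hY : IsDiffAt Y x) (hZ : IsDiffAt Z x) (u : TangentSpace (𝓡 n) x) :
    mvfderiv (𝓡 n) (fun y ↦ A.Φ y (Y y) (Z y)) x u
      = inner ℝ (A.covφ D x u (Y x)) (Z x) + A.Φ x (D Y x u) (Z x) + A.Φ x (Y x) (D Z x u) := by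
  have h := mvfderiv_inner hD (IsDiffAt.φField A hY) hZ u
  rw [connection_φField hD hY, inner_add_left, add_comm (inner ℝ _ _ : ℝ) (inner ℝ _ _ : ℝ)] at h
  exact h

lemma connection_ext_comm (hD : IsLeviCivita D) {x : M} (u v : TangentSpace (𝓡 n) x) :
    D (extField u) x v = D (extField v) x u := by
  have h := mlieBracket_eq hD (isDiffAt_ext u) (isDiffAt_ext v)
  rw [(mlieBracket_ext u v).self_of_nhds, extField_self, extField_self] at h
  exact (sub_eq_zero.1 h.symm).symm

omit [IsContMDiffRiemannianBundle (𝓡 n) ∞ (EuclideanSpace ℝ (Fin n))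
  (fun x : M ↦ TangentSpace (𝓡 n) x)] in
lemma Φ_swap (x : M) (u v : TangentSpace (𝓡 n) x) : A.Φ x u v = -A.Φ x v u := by
  rw [Φ, Φ, A.inner_φ_left, real_inner_comm]

/-- `dΦ` is the cyclic sum of `∇Φ`. -/
lemma dΦ_ext (hD : IsLeviCivita D) {x : M} (u v w : TangentSpace (𝓡 n) x) :
    A.dΦ (extField u) (extField v) (extField w) x
      = inner ℝ (A.covφ D x u v) w + inner ℝ (A.covφ D x v w) u + inner ℝ (A.covφ D x w u) v := by
  have hΦ0 (a : TangentSpace (𝓡 n) x) : A.Φ x 0 a = 0 := by simp [Φ]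
  have hv : (inner ℝ (A.covφ D x v w) u : ℝ) = -inner ℝ (A.covφ D x v u) w := by
    rw [inner_covφ hD.metric, real_inner_comm]
  rw [dΦ, mvfderiv_Φ hD.metric (isDiffAt_ext v) (isDiffAt_ext w),
    mvfderiv_Φ hD.metric (isDiffAt_ext u) (isDiffAt_ext w),
    mvfderiv_Φ hD.metric (isDiffAt_ext u) (isDiffAt_ext v),
    (mlieBracket_ext u v).self_of_nhds, (mlieBracket_ext u w).self_of_nhds,
    (mlieBracket_ext v w).self_of_nhds, hΦ0, hΦ0, hΦ0]
  simp only [extField_self]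
  rw [connection_ext_comm hD v u, connection_ext_comm hD w u, connection_ext_comm hD w v, hv,
    Φ_swap x (D (extField u) x w) v]
  ring

lemma dη_ext (hD : IsLeviCivita D) {x : M} (u v : TangentSpace (𝓡 n) x) :
    A.dη (extField u) (extField v) x = inner ℝ v (D A.ξ x u) - inner ℝ u (D A.ξ x v) := by
  have hξ := (A.isSmoothNear_ξ x).isDiffAt
  have e (a : TangentSpace (𝓡 n) x) : (fun y ↦ A.η y (extField a y))
      = fun y ↦ (inner ℝ (extField a y) (A.ξ y) : ℝ) := funext fun y ↦ A.η_eq y _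
  rw [dη, e, e, mvfderiv_inner hD.metric (isDiffAt_ext v) hξ,
    mvfderiv_inner hD.metric (isDiffAt_ext u) hξ, (mlieBracket_ext u v).self_of_nhds, map_zero]
  simp only [extField_self]
  rw [connection_ext_comm hD v u]
  ring

/-- The normality tensor in terms of `∇φ`. -/
lemma normalityTensor_ext (hD : IsLeviCivita D) {x : M} (u v : TangentSpace (𝓡 n) x) :
    A.normalityTensor (extField u) (extField v) x
      = A.covφ D x (A.φ x u) v - A.covφ D x (A.φ x v) u + A.φ x (A.covφ D x v u)
        - A.φ x (A.covφ D x u v) + A.dη (extField u) (extField v) x • A.ξ x := by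
  have hu := isDiffAt_ext u
  have hv := isDiffAt_ext v
  have hφu := IsDiffAt.φField A hu
  have hφv := IsDiffAt.φField A hv
  have e (a : TangentSpace (𝓡 n) x) : A.φField (extField a) x = A.φ x a := by simp [φField]
  rw [normalityTensor, mlieBracket_eq hD hφu hφv, mlieBracket_eq hD hφu hv,
    mlieBracket_eq hD hu hφv, mlieBracket_eq hD hu hv]
  simp only [connection_φField hD.metric hu, connection_φField hD.metric hv, extField_self, e,
    map_sub, map_add]
  abel

lemma inner_connection_ξ_ξ (hD : D.IsMetricCompatible) (x : M) (u : TangentSpace (𝓡 n) x) :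
    (inner ℝ (D A.ξ x u) (A.ξ x) : ℝ) = 0 := by
  have hξ := (A.isSmoothNear_ξ x).isDiffAt
  have h := mvfderiv_inner hD hξ hξ u
  have e : (fun y ↦ (inner ℝ (A.ξ y) (A.ξ y) : ℝ)) = fun _ ↦ 1 :=
    funext fun y ↦ by rw [A.inner_ξ, A.η_ξ]
  rw [e, mvfderiv_const, zero_apply, real_inner_comm] at h
  rw [real_inner_comm]
  linarith

lemma covφ_ξ (hD : D.IsMetricCompatible) (x : M) (u : TangentSpace (𝓡 n) x) :
    A.covφ D x u (A.ξ x) = -A.φ x (D A.ξ x u) := by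
  have h := connection_φField (A := A) hD (A.isSmoothNear_ξ x).isDiffAt u
  rw [φField_ξ, D.zero] at h
  exact (neg_eq_of_add_eq_zero_right h.symm).symm

end CovariantDerivativeOfPhi

section Structure

variable {A} {α : ℝ} {D : LinearConnection n M}

namespace IsAlphaCosymplectic

lemma inner_connection_ξ_comm (hA : A.IsAlphaCosymplectic α) (hD : IsLeviCivita D) (x : M)
    (u v : TangentSpace (𝓡 n) x) :
    (inner ℝ (D A.ξ x u) v : ℝ) = inner ℝ u (D A.ξ x v) := by
  have h := hA.dη_eq_zero x _ _ (isDiffAt_ext u) (isDiffAt_ext v)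
  rw [dη_ext hD] at h
  rw [real_inner_comm]
  linarith

lemma connection_ξ_ξ (hA : A.IsAlphaCosymplectic α) (hD : IsLeviCivita D) (x : M) :
    D A.ξ x (A.ξ x) = 0 := by
  refine ext_inner_right ℝ fun z ↦ ?_
  rw [hA.inner_connection_ξ_comm hD, real_inner_comm, inner_connection_ξ_ξ hD.metric,
    inner_zero_left]

lemma covφ_cyclic (hA : A.IsAlphaCosymplectic α) (hD : IsLeviCivita D) (x : M)
    (u v w : TangentSpace (𝓡 n) x) :
    inner ℝ (A.covφ D x u v) w + inner ℝ (A.covφ D x v w) u + inner ℝ (A.covφ D x w u) v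
      = 2 * α * A.ηWedgeΦ x u v w := by
  rw [← dΦ_ext hD, hA.dΦ_eq x _ _ _ (isDiffAt_ext u) (isDiffAt_ext v) (isDiffAt_ext w)]
  simp only [extField_self]

lemma covφ_normal (hA : A.IsAlphaCosymplectic α) (hD : IsLeviCivita D) (x : M)
    (u v : TangentSpace (𝓡 n) x) :
    A.covφ D x (A.φ x u) v - A.covφ D x (A.φ x v) u + A.φ x (A.covφ D x v u)
        - A.φ x (A.covφ D x u v) = 0 := by
  have h := hA.normal x _ _ (isDiffAt_ext u) (isDiffAt_ext v)
  rwa [normalityTensor_ext hD, hA.dη_eq_zero x _ _ (isDiffAt_ext u) (isDiffAt_ext v), zero_smul,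
    add_zero] at h

/-- Normality in the direction of `ξ`. -/
lemma covφ_ξ_left (hA : A.IsAlphaCosymplectic α) (hD : IsLeviCivita D) (x : M)
    (u : TangentSpace (𝓡 n) x) :
    A.covφ D x (A.ξ x) u = D A.ξ x (A.φ x u) - A.φ x (D A.ξ x u) := by
  have h0 : A.covφ D x 0 u = 0 := by simp [covφ]
  have h := hA.covφ_normal hD x u (A.ξ x)
  rw [covφ_ξ hD.metric, covφ_ξ hD.metric, A.φ_ξ, h0, sub_zero] at h
  have hη : A.η x (A.covφ D x (A.ξ x) u) = 0 := by
    rw [η_eq, inner_covφ hD.metric, covφ_ξ hD.metric, hA.connection_ξ_ξ hD]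
    simp
  have hη' (v) : A.η x (D A.ξ x v) = 0 := by rw [η_eq, inner_connection_ξ_ξ hD.metric]
  have h2 := congrArg (A.φ x) h
  simp only [map_add, map_sub, map_neg, A.φ_sq, hη, hη', map_zero, zero_smul,
    add_zero] at h2
  linear_combination (norm := module) -h2

/-- On the contact distribution `∇ξ` is multiplication by `α`. -/
lemma connection_ξ_φ (hA : A.IsAlphaCosymplectic α) (hD : IsLeviCivita D) (x : M)
    (v : TangentSpace (𝓡 n) x) : D A.ξ x (A.φ x v) = α • A.φ x v := by
  refine ext_inner_right ℝ fun w ↦ ?_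
  have h := hA.covφ_cyclic hD x (A.ξ x) v w
  rw [inner_covφ hD.metric x v, covφ_ξ hD.metric, covφ_ξ hD.metric, hA.covφ_ξ_left hD, ηWedgeΦ,
    A.η_ξ, Φ, Φ, Φ, A.φ_ξ, inner_zero_left, inner_zero_left, inner_sub_left, inner_neg_right,
    inner_neg_left, A.inner_φ_left x (D A.ξ x w), hA.inner_connection_ξ_comm hD x w] at h
  have h1 := real_inner_comm w (A.φ x (D A.ξ x v))
  have h2 := real_inner_comm w (D A.ξ x (A.φ x v))
  rw [real_inner_smul_left]
  linarith

/-- `∇_v ξ = α (v - η(v) ξ)`. -/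
lemma connection_ξ (hA : A.IsAlphaCosymplectic α) (hD : IsLeviCivita D) (x : M)
    (v : TangentSpace (𝓡 n) x) : D A.ξ x v = α • (v - A.η x v • A.ξ x) := by
  have h := hA.connection_ξ_φ hD x (A.φ x v)
  rw [A.φ_sq, map_add, map_neg, map_smul, hA.connection_ξ_ξ hD, smul_zero, add_zero] at h
  linear_combination (norm := module) -h

end IsAlphaCosymplectic

/-- A normal structure with `dη = 0` and `dΦ = 0` has `∇φ = 0`. On the contact distribution this
is the argument that makes an integrable almost Kähler structure Kähler: the tensor
`g((∇_{φu} φ)v, w) + g((∇_u φ)v, φw)` is symmetric in `u, v` by normality and skew in `v, w`, so it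
vanishes; then `dΦ = 0` at `(φu, v, w)`, `(φv, w, u)` and `(φw, u, v)` gives
`g((∇_u φ)v, φw) = 0`. -/
lemma IsAlphaCosymplectic.covφ_eq_zero (hA : A.IsAlphaCosymplectic 0) (hD : IsLeviCivita D) (x : M)
    (u v : TangentSpace (𝓡 n) x) : A.covφ D x u v = 0 := by
  have hξ (u) : A.covφ D x u (A.ξ x) = 0 := by
    rw [covφ_ξ hD.metric, hA.connection_ξ hD, zero_smul, map_zero, neg_zero]
  set P : TangentSpace (𝓡 n) x → TangentSpace (𝓡 n) x → TangentSpace (𝓡 n) x → ℝ :=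
    fun u v w ↦ inner ℝ (A.covφ D x u v) w with hP
  have skew (u v w) : P u v w = -P u w v := by
    simp only [hP]; rw [inner_covφ hD.metric, real_inner_comm]
  have cyc (u v w) : P u v w + P v w u + P w u v = 0 := by
    have := hA.covφ_cyclic hD x u v w
    simpa only [mul_zero, zero_mul] using this
  -- Differentiating `φ² = -1 + η ⊗ ξ`, where `∇ξ = 0`.
  have anti (u v) : A.covφ D x u (A.φ x v) = -A.φ x (A.covφ D x u v) := by
    have hv := isDiffAt_ext v
    have hξd := (A.isSmoothNear_ξ x).isDiffAt
    have hg : MDifferentiableAt (𝓡 n) 𝓘(ℝ, ℝ) (fun y ↦ (inner ℝ (extField v y) (A.ξ y) : ℝ)) x :=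
      hv.inner hξd
    have h := connection_φField (A := A) hD.metric (IsDiffAt.φField A hv) u
    have e : A.φField (A.φField (extField v))
        = ((-1 : ℝ) • extField v) + (fun y ↦ (inner ℝ (extField v y) (A.ξ y) : ℝ)) • A.ξ := by
      funext y
      change A.φ y (A.φ y _) = (-1 : ℝ) • extField v y
        + (inner ℝ (extField v y) (A.ξ y) : ℝ) • A.ξ y
      rw [A.φ_sq, A.η_eq, neg_one_smul]
    have e' : A.φField (extField v) x = A.φ x v := by simp [φField]
    have hDξ : D A.ξ x u = 0 := by rw [hA.connection_ξ hD, zero_smul]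
    have hneg : IsDiffAt ((-1 : ℝ) • extField v) x := mdifferentiableAt_const.smul_section hv
    rw [e, D.isCovariantDerivativeOnUniv.add hneg
      (hg.smul_section hξd), D.isCovariantDerivativeOnUniv.leibniz hξd hg,
      D.isCovariantDerivativeOnUniv.smul_const _ hv] at h
    simp only [add_apply, smul_apply, ContinuousLinearMap.smulRight_apply,
      mvfderiv_inner hD.metric hv hξd, hDξ, smul_zero, inner_zero_right, add_zero, zero_add,
      connection_φField hD.metric hv, map_add, A.φ_sq, e', extField_self, A.η_eq] at h
    linear_combination (norm := module) -h
  have move (u v w) : P u (A.φ x v) w = P u v (A.φ x w) := by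
    simp only [hP]; rw [anti, inner_neg_left, A.inner_φ_right]
  have norm (u v w) :
      P (A.φ x u) v w - P (A.φ x v) u w - P v u (A.φ x w) + P u v (A.φ x w) = 0 := by
    have := congrArg (fun a ↦ (inner ℝ a w : ℝ)) (hA.covφ_normal hD x u v)
    simp only [inner_sub_left, inner_add_left, inner_zero_left, A.inner_φ_left x (A.covφ D x _ _)]
      at this
    simp only [hP]
    linarith
  have skew' (u v w) : P u v (A.φ x w) = -P u w (A.φ x v) := by rw [skew, move]
  have J (u v w) : P (A.φ x u) v w = -P u v (A.φ x w) := by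
    linarith [norm u v w, norm v w u, norm w u v, skew (A.φ x u) v w, skew (A.φ x v) w u,
      skew (A.φ x w) u v, skew' u v w, skew' v w u, skew' w u v]
  have q (u v w) : P u v (A.φ x w) = 0 := by
    have c1 := cyc (A.φ x u) v w
    have c2 := cyc (A.φ x v) w u
    have c3 := cyc (A.φ x w) u v
    rw [J, move] at c1 c2 c3
    linarith
  refine ext_inner_right ℝ fun w ↦ ?_
  have hw : w = A.η x w • A.ξ x - A.φ x (A.φ x w) := by rw [A.φ_sq]; module
  have h1 : P u v (A.ξ x) = 0 := by rw [skew]; simp [hP, hξ]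
  have h2 := q u v (A.φ x w)
  simp only [hP] at h1 h2
  rw [hw, inner_sub_right, inner_smul_right, h1, h2]
  simp

end Structure

end AlmostContactMetricStructure

/-! ### The quarter-symmetric connection, curvature and traces -/

namespace AlmostContactMetricStructure

variable {n : ℕ} {M : Type*} [TopologicalSpace M]
  [ChartedSpace (EuclideanSpace ℝ (Fin n)) M] [IsManifold (𝓡 n) ∞ M]
  [RiemannianBundle (fun x : M ↦ TangentSpace (𝓡 n) x)]
  [IsContMDiffRiemannianBundle (𝓡 n) ∞ (EuclideanSpace ℝ (Fin n))
  (fun x : M ↦ TangentSpace (𝓡 n) x)]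
  {A : AlmostContactMetricStructure n M} {D D' : LinearConnection n M}

/-- The quarter-symmetric metric connection is `∇ - η ⊗ φ`. The difference of the two sides,
as a trilinear form, is symmetric in the first two arguments and skew in the last two. -/
lemma IsQuarterSymmetricMetric.connection_eq (hD' : A.IsQuarterSymmetricMetric D')
    (hD : IsLeviCivita D) {Z : Π x : M, TangentSpace (𝓡 n) x} {x : M} (hZ : IsDiffAt Z x)
    (u : TangentSpace (𝓡 n) x) : D' Z x u = D Z x u - A.η x u • A.φ x (Z x) := by
  have skew {Y W : Π x : M, TangentSpace (𝓡 n) x} (hY : IsDiffAt Y x) (hW : IsDiffAt W x)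
      (u : TangentSpace (𝓡 n) x) :
      (inner ℝ (D' Y x u - D Y x u + A.η x u • A.φ x (Y x)) (W x) : ℝ)
        = -inner ℝ (Y x) (D' W x u - D W x u + A.η x u • A.φ x (W x)) := by
    have h1 := mvfderiv_inner hD.metric hY hW u
    rw [mvfderiv_inner hD'.metric hY hW u] at h1
    have h2 := A.inner_φ_left x (Y x) (W x)
    simp only [inner_add_left, inner_sub_left, inner_add_right, inner_sub_right,
      real_inner_smul_left, real_inner_smul_right, h2]
    linarith
  set K : TangentSpace (𝓡 n) x → TangentSpace (𝓡 n) x → TangentSpace (𝓡 n) x :=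
    fun u v ↦ D' (extField v) x u - D (extField v) x u + A.η x u • A.φ x v with hK
  have symm (u v) : K u v = K v u := by
    have h := hD'.torsion_eq x u v
    rw [CovariantDerivative.torsion_apply_eq_extend] at h
    rw [(mlieBracket_ext u v).self_of_nhds] at h
    simp only [FiberBundle.extend_apply_self, sub_zero] at h
    simp only [hK]
    rw [connection_ext_comm hD v u]
    linear_combination (norm := module) h
  have sk (u v w) : (inner ℝ (K u v) w : ℝ) = -inner ℝ (K u w) v := by
    have h := skew (isDiffAt_ext v) (isDiffAt_ext w) u
    simp only [extField_self] at h
    rw [real_inner_comm v (K u w)]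
    exact h
  have zero (u v) : K u v = 0 := by
    refine ext_inner_right ℝ fun w ↦ ?_
    have h1 := sk u v w
    have h2 := sk v w u
    have h3 := sk w u v
    rw [symm w u] at h3
    rw [symm v w] at h2
    rw [symm v u] at h2
    rw [inner_zero_left]
    linarith
  have h0 : D' Z x u - D Z x u + A.η x u • A.φ x (Z x) = 0 := by
    refine ext_inner_right ℝ fun w ↦ ?_
    have h := skew hZ (isDiffAt_ext w) u
    simp only [extField_self] at h
    rw [h, inner_zero_left, neg_eq_zero]
    have := zero u w
    simp only [hK] at this
    rw [this, inner_zero_right]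
  linear_combination (norm := module) h0

section Cosymplectic

variable [T2Space M]

/-- In the cosymplectic case, the quarter-symmetric metric connection has the curvature of the
Levi-Civita connection, as `∇φ = 0` and `dη = 0`. -/
lemma IsAlphaCosymplectic.curvature_eq (hA : A.IsAlphaCosymplectic 0) (hD : IsLeviCivita D)
    (hD' : A.IsQuarterSymmetricMetric D') (x : M) (u v w : TangentSpace (𝓡 n) x) :
    curvature D' x u v w = curvature D x u v w := by
  have hw := isSmoothNear_ext w
  have key (a b : TangentSpace (𝓡 n) x) : D' (fun y ↦ D' (extField w) y (extField b y)) x a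
      = D (fun y ↦ D (extField w) y (extField b y)) x a - A.η x b • A.φ x (D (extField w) x a)
        - A.η x a • A.φ x (D (extField w) x b)
        + (A.η x a * A.η x b) • A.φ x (A.φ x w)
        - mvfderiv (𝓡 n) (fun y ↦ A.η y (extField b y)) x a • A.φ x w := by
    have hb := isSmoothNear_ext b
    have hσ := hw.connection hD.smooth hb
    have hτ := IsSmoothNear.φField A hw
    set g : M → ℝ := fun y ↦ A.η y (extField b y) with hg
    have hgd : MDifferentiableAt (𝓡 n) 𝓘(ℝ, ℝ) (-g) x := by
      have : g = fun y ↦ (inner ℝ (extField b y) (A.ξ y) : ℝ) := funext fun y ↦ A.η_eq y _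
      rw [this]
      exact (hb.isDiffAt.inner (A.isSmoothNear_ξ x).isDiffAt).neg
    have hgτ : IsDiffAt ((-g) • A.φField (extField w)) x := hgd.smul_section hτ.isDiffAt
    have hW' : IsDiffAt
        ((fun y ↦ D (extField w) y (extField b y)) + (-g) • A.φField (extField w)) x :=
      mdifferentiableAt_add_section hσ.isDiffAt hgτ
    have e : ∀ᶠ y in 𝓝 x, D' (extField w) y (extField b y)
        = ((fun y ↦ D (extField w) y (extField b y)) + (-g) • A.φField (extField w)) y := by
      filter_upwards [hw.eventually] with y hy
      rw [hD'.connection_eq hD hy.isDiffAt, sub_eq_add_neg, ← neg_smul]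
      rfl
    rw [connection_congr D' (hw.connection hD'.smooth hb).isDiffAt hW' e,
      hD'.connection_eq hD hW', D.isCovariantDerivativeOnUniv.add hσ.isDiffAt hgτ,
      D.isCovariantDerivativeOnUniv.leibniz hτ.isDiffAt hgd, mvfderiv_neg]
    have e1 : A.φField (extField w) x = A.φ x w := by simp [φField]
    have e2 : g x = A.η x b := by simp [hg]
    simp only [add_apply, smul_apply, ContinuousLinearMap.smulRight_apply, neg_apply, Pi.add_apply,
      Pi.neg_apply, Pi.smul_apply', connection_φField hD.metric hw.isDiffAt,
      hA.covφ_eq_zero hD, e1, e2, map_add, map_smul, extField_self]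
    module
  have hη := hA.dη_eq_zero x _ _ (isDiffAt_ext u) (isDiffAt_ext v)
  rw [dη, (mlieBracket_ext u v).self_of_nhds, map_zero, sub_zero, extField_self,
    extField_self] at hη
  rw [AlphaCosymplectic.curvature_eq, AlphaCosymplectic.curvature_eq, curvatureOfFields_ext,
    curvatureOfFields_ext, key, key, sub_eq_zero.1 hη]
  module

/-- The curvature operators commute with the parallel tensor field `φ`. -/
lemma IsAlphaCosymplectic.curvature_φ (hA : A.IsAlphaCosymplectic 0) (hD : IsLeviCivita D)
    (x : M) (u v w : TangentSpace (𝓡 n) x) :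
    curvature D x u v (A.φ x w) = A.φ x (curvature D x u v w) := by
  have hw := isSmoothNear_ext w
  have hφw := IsSmoothNear.φField A hw
  have key (a b : TangentSpace (𝓡 n) x) : D (fun y ↦ D (A.φField (extField w)) y (extField b y)) x a
      = A.φ x (D (fun y ↦ D (extField w) y (extField b y)) x a) := by
    have hb := isSmoothNear_ext b
    have hσ := hw.connection hD.smooth hb
    have e : ∀ᶠ y in 𝓝 x, D (A.φField (extField w)) y (extField b y)
        = A.φField (fun y ↦ D (extField w) y (extField b y)) y := by
      filter_upwards [hw.eventually] with y hy
      rw [connection_φField hD.metric hy.isDiffAt, hA.covφ_eq_zero hD, add_zero]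
      rfl
    rw [connection_congr D (hφw.connection hD.smooth hb).isDiffAt
      (IsSmoothNear.φField A hσ).isDiffAt e, connection_φField hD.metric hσ.isDiffAt,
      hA.covφ_eq_zero hD, add_zero]
  have h := curvatureOfFields_eq_curvature hD.smooth hD.metric u v hφw
  have e : A.φField (extField w) x = A.φ x w := by simp [φField]
  rw [e] at h
  rw [← h, AlphaCosymplectic.curvature_eq, curvatureOfFields_ext, curvatureOfFields_ext, key, key,
    map_sub]

lemma IsAlphaCosymplectic.curvature_ξ (hA : A.IsAlphaCosymplectic 0) (hD : IsLeviCivita D)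
    (x : M) (u v : TangentSpace (𝓡 n) x) : curvature D x u v (A.ξ x) = 0 := by
  have h (b : TangentSpace (𝓡 n) x) : (fun y ↦ D A.ξ y (extField b y)) = 0 :=
    funext fun y ↦ by rw [hA.connection_ξ hD, zero_smul]; rfl
  rw [← curvatureOfFields_eq_curvature hD.smooth hD.metric u v (A.isSmoothNear_ξ x),
    curvatureOfFields_ext, h, h, D.zero]
  simp

/-- Moving a skew-adjoint operator through a trace of a bilinear form. -/
lemma _root_.OrthonormalBasis.sum_bilin_skew {ι V : Type*} [Fintype ι] [NormedAddCommGroup V]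
    [InnerProductSpace ℝ V] (b : OrthonormalBasis ι ℝ V) (B : V →ₗ[ℝ] V →ₗ[ℝ] ℝ) (T : V → V)
    (hT : ∀ v w, inner ℝ v (T w) = -inner ℝ (T v) w) :
    ∑ i, B (T (b i)) (b i) = -∑ i, B (b i) (T (b i)) := by
  have e (i : ι) : T (b i) = ∑ k, inner ℝ (b k) (T (b i)) • b k := (b.sum_repr' _).symm
  have h1 : ∑ i, B (T (b i)) (b i) = ∑ i, ∑ k, inner ℝ (b k) (T (b i)) * B (b k) (b i) := by
    refine Finset.sum_congr rfl fun i _ ↦ ?_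
    conv_lhs => rw [e i]
    simp
  have h2 : ∑ i, B (b i) (T (b i)) = ∑ i, ∑ k, inner ℝ (b k) (T (b i)) * B (b i) (b k) := by
    refine Finset.sum_congr rfl fun i _ ↦ ?_
    conv_lhs => rw [e i]
    simp
  rw [h1, h2, Finset.sum_comm, ← Finset.sum_neg_distrib]
  refine Finset.sum_congr rfl fun i _ ↦ ?_
  rw [← Finset.sum_neg_distrib]
  refine Finset.sum_congr rfl fun k _ ↦ ?_
  rw [hT, real_inner_comm, neg_mul]

/-- In the cosymplectic case the `∗`-scalar curvature is the scalar curvature, as for Kähler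
manifolds: by the Bianchi identity, `-g(R(eᵢ, φeᵢ)eⱼ, φeⱼ)` is the sum of two terms, each of which
has the trace of the Ricci tensor. -/
lemma IsAlphaCosymplectic.starScalarCurvature_eq (hA : A.IsAlphaCosymplectic 0)
    (hD : IsLeviCivita D) (x : M) : A.starScalarCurvature D x = scalarCurvature D x := by
  set b := stdOrthonormalBasis ℝ (TangentSpace (𝓡 n) x) with hb
  have h2 (i j) : (inner ℝ (curvature D x (b j) (b i) (A.φ x (b i))) (A.φ x (b j)) : ℝ)
      = inner ℝ (curvature D x (b j) (b i) (b i)) (b j) := by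
    have hη : A.η x (curvature D x (b j) (b i) (b i)) = 0 := by
      rw [A.η_eq, inner_curvature_swap hD.smooth hD.metric, hA.curvature_ξ hD, inner_zero_right,
        neg_zero]
    rw [hA.curvature_φ hD, A.inner_φ_φ, hη, zero_mul, sub_zero]
  have h1 (j) : ∑ i, (inner ℝ (curvature D x (A.φ x (b i)) (b j) (b i)) (A.φ x (b j)) : ℝ)
      = ∑ i, inner ℝ (curvature D x (b j) (b i) (b i)) (b j) := by
    have hl (a c) : (inner ℝ (curvature D x a (b j) c) (A.φ x (b j)) : ℝ)
        = -inner ℝ a (curvature D x c (A.φ x (b j)) (b j)) := inner_curvature_left hD _ _ _ _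
    have hr (a c) : (inner ℝ (curvature D x a (b j) c) (A.φ x (b j)) : ℝ)
        = -inner ℝ c (curvature D x a (b j) (A.φ x (b j))) :=
      inner_curvature_swap hD.smooth hD.metric _ _ _ _
    have := b.sum_bilin_skew (LinearMap.mk₂ ℝ
      (fun a c ↦ (inner ℝ (curvature D x a (b j) c) (A.φ x (b j)) : ℝ))
      (fun a a' c ↦ by rw [hl, hl, hl, inner_add_left]; ring)
      (fun r a c ↦ by rw [hl, hl, real_inner_smul_left]; simp)
      (fun a c c' ↦ by rw [hr, hr, hr, inner_add_left]; ring)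
      (fun r a c ↦ by rw [hr, hr, real_inner_smul_left]; simp)) (A.φ x) (A.inner_φ_right x)
    simp only [LinearMap.mk₂_apply] at this
    rw [this, ← Finset.sum_neg_distrib]
    refine Finset.sum_congr rfl fun i _ ↦ ?_
    rw [← h2, curvature_swap, inner_neg_left, neg_neg]
  have h3 (i j) : (inner ℝ (A.φ x (curvature D x (b i) (A.φ x (b i)) (b j))) (b j) : ℝ)
      = inner ℝ (curvature D x (A.φ x (b i)) (b j) (b i)) (A.φ x (b j))
        + inner ℝ (curvature D x (b j) (b i) (b i)) (b j) := by
    have h := congrArg (fun a ↦ (inner ℝ a (A.φ x (b j)) : ℝ))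
      (curvature_bianchi hD (b i) (A.φ x (b i)) (b j))
    simp only [inner_add_left, inner_zero_left] at h
    rw [A.inner_φ_left, ← h2]
    linarith
  simp only [starScalarCurvature, starRicci, scalarCurvature, ricci, metricTrace, ← hb, h3]
  rw [← Finset.mul_sum, Finset.sum_comm]
  simp only [Finset.sum_add_distrib, h1]
  rw [Finset.sum_comm]
  ring

end Cosymplectic

omit [IsManifold (𝓡 n) ∞ M] [RiemannianBundle (fun x : M ↦ TangentSpace (𝓡 n) x)]
  [IsContMDiffRiemannianBundle (𝓡 n) ∞ (EuclideanSpace ℝ (Fin n))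
  (fun x : M ↦ TangentSpace (𝓡 n) x)] in
lemma _root_.AlphaCosymplectic.finrank_tangentSpace (x : M) :
    Module.finrank ℝ (TangentSpace (𝓡 n) x) = n :=
  finrank_euclideanSpace_fin (𝕜 := ℝ) (n := n)

/-- `div ξ = (n - 1) α`. -/
lemma IsAlphaCosymplectic.divergence_ξ {α : ℝ} (hA : A.IsAlphaCosymplectic α)
    (hD : IsLeviCivita D) (x : M) : divergence D A.ξ x = ((n : ℝ) - 1) * α := by
  set b := stdOrthonormalBasis ℝ (TangentSpace (𝓡 n) x) with hb
  have h (i) : (inner ℝ (D A.ξ x (b i)) (b i) : ℝ)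
      = α * (1 - inner ℝ (b i) (A.ξ x) * inner ℝ (b i) (A.ξ x)) := by
    rw [hA.connection_ξ hD, real_inner_smul_left, inner_sub_left, real_inner_smul_left, A.η_eq,
      real_inner_self_eq_norm_sq, b.norm_eq_one, real_inner_comm (b i) (A.ξ x)]
    ring
  have hs : ∑ i, (inner ℝ (b i) (A.ξ x) : ℝ) * inner ℝ (b i) (A.ξ x) = 1 := by
    have := b.sum_inner_mul_inner (A.ξ x) (A.ξ x)
    rw [A.inner_ξ, A.η_ξ] at this
    rw [← this]
    exact Finset.sum_congr rfl fun i _ ↦ by rw [real_inner_comm (A.ξ x) (b i)]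
  simp only [divergence, metricTrace, ← hb, h]
  rw [← Finset.mul_sum, Finset.sum_sub_distrib, hs]
  simp [finrank_tangentSpace]
  ring

omit [IsContMDiffRiemannianBundle (𝓡 n) ∞ (EuclideanSpace ℝ (Fin n))
  (fun x : M ↦ TangentSpace (𝓡 n) x)] in
/-- In dimension one the contact distribution is trivial, so `φ = 0`. -/
lemma φ_eq_zero_of_dim_one (hn : n = 1) (x : M) (v : TangentSpace (𝓡 n) x) : A.φ x v = 0 := by
  have hξ : A.ξ x ≠ 0 := fun h ↦ by simpa [h] using A.η_ξ x
  obtain ⟨c, rfl⟩ := (finrank_eq_one_iff_of_nonzero' (A.ξ x) hξ).1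
    ((finrank_tangentSpace x).trans hn) v
  rw [map_smul, A.φ_ξ, smul_zero]

omit [IsContMDiffRiemannianBundle (𝓡 n) ∞ (EuclideanSpace ℝ (Fin n))
  (fun x : M ↦ TangentSpace (𝓡 n) x)] in
lemma _root_.AlphaCosymplectic.scalarCurvature_of_dim_one (hn : n = 1) (D : LinearConnection n M)
    (x : M) : scalarCurvature D x = 0 := by
  have : Subsingleton (Fin (Module.finrank ℝ (TangentSpace (𝓡 n) x))) := by
    rw [finrank_tangentSpace, hn]; infer_instance
  have h (v w : TangentSpace (𝓡 n) x) : curvature D x v v w = 0 := by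
    rw [AlphaCosymplectic.curvature_eq, curvatureOfFields_ext, sub_self]
  simp only [scalarCurvature, ricci, metricTrace]
  refine Finset.sum_eq_zero fun i _ ↦ Finset.sum_eq_zero fun j _ ↦ ?_
  rw [Subsingleton.elim j i, h, inner_zero_left]

/-- Evaluation of the `∗`-`η`-Yamabe equation at `(ξ, ξ)`. -/
lemma IsStarEtaYamabeSoliton.add_eq {Λ μ : ℝ} (h : A.IsStarEtaYamabeSoliton D' Λ μ)
    (hD' : D'.IsMetricCompatible) (x : M) : Λ + μ = (1 / 2 : ℝ) * A.starScalarCurvature D' x := by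
  have h := h x (A.ξ x) (A.ξ x)
  have h1 := inner_connection_ξ_ξ (A := A) hD' x (A.ξ x)
  have h2 := real_inner_comm (A.ξ x) (D' A.ξ x (A.ξ x))
  rw [lieDerivMetric, A.η_ξ, A.inner_ξ x (A.ξ x), A.η_ξ] at h
  linarith

end AlmostContactMetricStructure

end AlphaCosymplectic

end

theorem theorem6p3 {n : ℕ} {M : Type*} [TopologicalSpace M]
    [T2Space M] [SecondCountableTopology M] [ConnectedSpace M]
    [ChartedSpace (EuclideanSpace ℝ (Fin n)) M] [IsManifold (𝓡 n) ∞ M]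
    [RiemannianBundle (fun x : M ↦ TangentSpace (𝓡 n) x)]
    [IsContMDiffRiemannianBundle (𝓡 n) ∞ (EuclideanSpace ℝ (Fin n))
      (fun x : M ↦ TangentSpace (𝓡 n) x)]
    -- the `α`-cosymplectic structure
    (A : AlphaCosymplectic.AlmostContactMetricStructure n M) (α : ℝ)
    (hA : A.IsAlphaCosymplectic α)
    -- the Levi-Civita connection `D` and a quarter-symmetric metric connection `D'`
    (D : AlphaCosymplectic.LinearConnection n M) (hD : AlphaCosymplectic.IsLeviCivita D)
    (D' : AlphaCosymplectic.LinearConnection n M) (hD' : A.IsQuarterSymmetricMetric D')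
    -- the soliton with respect to `D'`
    (Λ μ : ℝ) (hsol : A.IsStarEtaYamabeSoliton D' Λ μ)
    -- `ξ` is the gradient of a smooth harmonic function
    (f : M → ℝ) (hf : ContMDiff (𝓡 n) 𝓘(ℝ, ℝ) ∞ f)
    (hξ : ∀ x : M, A.ξ x = AlphaCosymplectic.gradient f x)
    (hharm : ∀ x : M, AlphaCosymplectic.laplacian D f x = 0) :
    ∀ x : M,
      (AlphaCosymplectic.IsExpanding Λ ↔
        μ < (1 / 2 : ℝ) * (AlphaCosymplectic.scalarCurvature D x + α ^ 2 * ((n : ℝ) - 1) ^ 2)) ∧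
      (AlphaCosymplectic.IsSteady Λ ↔
        (1 / 2 : ℝ) * (AlphaCosymplectic.scalarCurvature D x + α ^ 2 * ((n : ℝ) - 1) ^ 2) = μ) ∧
      (AlphaCosymplectic.IsShrinking Λ ↔
        (1 / 2 : ℝ) * (AlphaCosymplectic.scalarCurvature D x + α ^ 2 * ((n : ℝ) - 1) ^ 2) < μ) := by
  intro x
  -- `0 = Δ f = div ξ = (n - 1) α`, so either `n = 1` or the structure is cosymplectic.
  have hαn : ((n : ℝ) - 1) * α = 0 := by
    have h := hharm x
    rw [AlphaCosymplectic.laplacian, ← funext hξ, hA.divergence_ξ hD] at h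
    exact h
  have hr : A.starScalarCurvature D' x
      = AlphaCosymplectic.scalarCurvature D x + α ^ 2 * ((n : ℝ) - 1) ^ 2 := by
    rw [← mul_pow, mul_comm α, hαn]
    rcases mul_eq_zero.1 hαn with hn | rfl
    · have hn1 : n = 1 := by exact_mod_cast sub_eq_zero.1 hn
      have hφ := AlphaCosymplectic.AlmostContactMetricStructure.φ_eq_zero_of_dim_one (A := A) hn1 x
      rw [AlphaCosymplectic.scalarCurvature_of_dim_one hn1]
      simp [AlphaCosymplectic.AlmostContactMetricStructure.starScalarCurvature,
        AlphaCosymplectic.AlmostContactMetricStructure.starRicci,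
        AlphaCosymplectic.metricTrace, hφ]
    · have e : A.starScalarCurvature D' x = A.starScalarCurvature D x := by
        refine congrArg (AlphaCosymplectic.metricTrace x) (funext fun v ↦ funext fun w ↦ ?_)
        simp only [AlphaCosymplectic.AlmostContactMetricStructure.starRicci,
          hA.curvature_eq hD hD']
      rw [e, hA.starScalarCurvature_eq hD]
      ring
  have hΛ : Λ + μ = (1 / 2 : ℝ) * A.starScalarCurvature D' x := hsol.add_eq hD'.metric x
  rw [hr] at hΛ
  rw [← hΛ, AlphaCosymplectic.IsExpanding, AlphaCosymplectic.IsSteady,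
    AlphaCosymplectic.IsShrinking]
  refine ⟨?_, ?_, ?_⟩ <;> constructor <;> intro h <;> linarith
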